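/- Let $d$ and $N$ be non-negative integers. A function $f:G\to\mathbb{C}$ on an open subset $G$ of a Euclidean space is called polyharmonic of order $N$ if it is $2N$ times continuously differentiable and $\Delta^{N}f(x)=0$ for all $x\in G$, where $\Delta^N$ is the $N$-th iterate of the Laplace operator (in $\mathbb{R}\times\mathbb{R}^{d}$, the Laplace operator in all $d+1$ variables $(t,y)$). Let $a<b$ be real numbers. A function $u:(a,b)\times\mathbb{R}^{d}\to\mathbb{C}$ is called odd at $t_{0}\in(a,b)$ if $u(t_{0}+t,y)=-u(t_{0}-t,y)$ for all $y\in\mathbb{R}^{d}$ and all real $t$ with $|t|<c$, where $c=\min\{b-t_{0},\,t_{0}-a\}$. **Theorem.** Let $u:(a,b)\times\mathbb{R}^{d}\to\mathbb{C}$ be polyharmonic of order $N$ and odd at two points $t_{1}<t_{2}$ of $(a,b)$. Put $\delta=t_{2}-t_{1}$ and suppose that $a<t_{1}-\delta$ and $t_{2}+\delta<b$. Then there exists a function $\widetilde{u}:\mathbb{R}\times\mathbb{R}^{d}\to\mathbb{C}$, polyharmonic of order $N$, such that $\widetilde{u}(t,y)=u(t,y)$ for all $(t,y)\in(a,b)\times\mathbb{R}^{d}$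 and $$\widetilde{u}(t+2(t_{2}-t_{1}),y)=\widetilde{u}(t,y)\qquad\text{for all }(t,y)\in\mathbb{R}\times\mathbb{R}^{d}.$$ -/

import Mathlib

open scoped Laplacian

/-- `f` is polyharmonic of order `N` on the (open) set `G`: it is `2N` times continuously
differentiable on `G` and the `N`-th iterate of the Laplace operator applied to `f` vanishes
at every point of `G`. -/
def PolyharmonicOn {E : Type*} [NormedAddCommGroup E] [InnerProductSpace ℝ E]
    [FiniteDimensional ℝ E] (N : ℕ) (f : E → ℂ) (G : Set E) : Prop :=
  ContDiffOn ℝ ((2 * N : ℕ) : WithTop ℕ∞) f G ∧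
    ∀ x ∈ G, ((fun g : E → ℂ => Δ g)^[N] f) x = 0

/-- The Euclidean space `ℝ × ℝ^d` of points `(t, y)`, with the Euclidean (`ℓ²`) product structure. -/
abbrev TimeSpace (d : ℕ) : Type := WithLp 2 (ℝ × EuclideanSpace ℝ (Fin d))

/-- The strip `(a, b) × ℝ^d`. -/
def strip (d : ℕ) (a b : ℝ) : Set (TimeSpace d) := {p | a < p.fst ∧ p.fst < b}

/-- A function `u` on the strip `(a, b) × ℝ^d` is odd at `t₀ ∈ (a, b)`:
`u(t₀ + t, y) = -u(t₀ - t, y)` for all `y` and all `t` with `|t| < c`, where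
`c = min (b - t₀) (t₀ - a)`, i.e. whenever both points lie in the strip. -/
def OddAt {d : ℕ} (a b : ℝ) (u : TimeSpace d → ℂ) (t₀ : ℝ) : Prop :=
  ∀ t ∈ Set.Ioo (-(min (b - t₀) (t₀ - a))) (min (b - t₀) (t₀ - a)),
    ∀ y : EuclideanSpace ℝ (Fin d),
      u (WithLp.toLp 2 (t₀ + t, y)) = -u (WithLp.toLp 2 (t₀ - t, y))

open Set Metric MeasureTheory Filter
open scoped Topology ContDiff RealInnerProductSpace

section RadialKernel

variable {E : Type*} [NormedAddCommGroup E] [InnerProductSpace ℝ E] [FiniteDimensional ℝ E]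

theorem hasCompactSupport_of_one_le_norm {F : Type*} [Zero F] {K : E → F}
    (hK : ∀ z, 1 ≤ ‖z‖ → K z = 0) : HasCompactSupport K := by
  refine HasCompactSupport.intro (isCompact_closedBall (0 : E) 1) fun z hz => hK z ?_
  simp only [mem_closedBall, dist_zero_right, not_le] at hz
  exact hz.le

/-- A normalized smooth radial kernel `K` supported in the unit ball, together with a function `ψ`
supported in the unit ball whose gradient is `-K z • z`. -/
theorem exists_radial_kernel [MeasurableSpace E] [BorelSpace E] :
    ∃ K ψ : E → ℝ, ContDiff ℝ ∞ K ∧ (∀ z, 1 ≤ ‖z‖ → K z = 0) ∧ (∀ z, 1 ≤ ‖z‖ → ψ z = 0) ∧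
      (∀ z, HasFDerivAt ψ (-(K z) • innerSL ℝ z) z) ∧ ∫ z, K z = 1 := by
  set p : Polynomial ℝ := Polynomial.X ^ 2 with hp
  set φ : E → ℝ := fun z => p.eval (1 - ‖z‖ ^ 2)⁻¹ * expNegInvGlue (1 - ‖z‖ ^ 2) with hφ
  have hφs : ContDiff ℝ ∞ φ :=
    (expNegInvGlue.contDiff_polynomial_eval_inv_mul (n := ⊤) p).comp
      (contDiff_const.sub (contDiff_norm_sq ℝ))
  have hφ0 : ∀ z : E, 1 ≤ ‖z‖ → expNegInvGlue (1 - ‖z‖ ^ 2) = 0 := fun z hz =>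
    expNegInvGlue.zero_of_nonpos (by nlinarith)
  have hφ1 : ∀ z : E, 1 ≤ ‖z‖ → φ z = 0 := fun z hz => by simp [hφ, hφ0 z hz]
  have hφnn : 0 ≤ φ := fun z =>
    mul_nonneg (by simp [hp]; positivity) (expNegInvGlue.nonneg _)
  have hφpos : 0 < ∫ z, φ z := by
    refine hφs.continuous.integral_pos_of_hasCompactSupport_nonneg_nonzero
      (hasCompactSupport_of_one_le_norm hφ1) hφnn (x := 0) ?_
    simp [hφ, hp]
  set c := ∫ z, φ z with hc
  refine ⟨fun z => c⁻¹ * φ z, fun z => c⁻¹ * (expNegInvGlue (1 - ‖z‖ ^ 2) / 2),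
    contDiff_const.mul hφs, fun z hz => by simp [hφ1 z hz], fun z hz => by simp [hφ0 z hz],
    fun z => ?_, ?_⟩
  · have h1 := expNegInvGlue.hasDerivAt_polynomial_eval_inv_mul 1 (1 - ‖z‖ ^ 2)
    simp only [Polynomial.eval_one, one_mul, Polynomial.derivative_one, sub_zero, mul_one] at h1
    have h2 : HasFDerivAt (fun z : E => 1 - ‖z‖ ^ 2) (-(2 • innerSL ℝ z)) z := by
      simpa using (hasStrictFDerivAt_norm_sq z).hasFDerivAt.const_sub 1
    have h3 := ((h1.comp_hasFDerivAt z h2).mul_const (2 : ℝ)⁻¹).const_mul c⁻¹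
    refine (h3.congr_fderiv ?_)
    ext w
    simp [hφ, hp]
    ring
  · rw [integral_const_mul, inv_mul_cancel₀ hφpos.ne']

end RadialKernel

section MeanValue

variable {E : Type*} [NormedAddCommGroup E] [InnerProductSpace ℝ E] [FiniteDimensional ℝ E]

/-- A function of class `C^n` near a closed ball coincides near that ball with a compactly supported
function of class `C^n`. -/
theorem exists_hasCompactSupport_eqOn_ball {n : ℕ∞} {f : E → ℂ} {G : Set E}
    (hf : ContDiffOn ℝ n f G) (hG : IsOpen G) {y : E} {r : ℝ} (hr : 0 ≤ r)
    (hyr : closedBall y r ⊆ G) :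
    ∃ f₁ : E → ℂ, ∃ ε > 0, ContDiff ℝ n f₁ ∧ HasCompactSupport f₁ ∧ ball y (r + ε) ⊆ G ∧
      EqOn f₁ f (ball y (r + ε)) := by
  obtain ⟨δ, hδ, hδG⟩ := (isCompact_closedBall y r).exists_cthickening_subset_open hG hyr
  rw [cthickening_closedBall hδ.le hr, add_comm] at hδG
  let χ : ContDiffBump y := ⟨r + δ / 3, r + 2 * δ / 3, by positivity, by linarith⟩
  have hχ : ∀ x, r + 2 * δ / 3 ≤ dist x y → χ x = 0 := fun x hx => χ.zero_of_le_dist hx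
  refine ⟨fun x => χ x • f x, δ / 3, by positivity, ?_, ?_, ?_, ?_⟩
  · rw [contDiff_iff_contDiffAt]
    intro x
    by_cases hx : x ∈ G
    · exact χ.contDiff.contDiffAt.smul (hf.contDiffAt (hG.mem_nhds hx))
    · have hx' : r + 2 * δ / 3 < dist x y := by
        by_contra! h
        exact hx (hδG (mem_closedBall.2 (by linarith)))
      refine (contDiffAt_const (c := (0 : ℂ))).congr_of_eventuallyEq ?_
      filter_upwards [(continuous_id.dist continuous_const).continuousAt.eventually
        (lt_mem_nhds hx')] with z hz
      simp [hχ z hz.le]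
  · refine HasCompactSupport.intro (isCompact_closedBall y (r + δ)) fun x hx => ?_
    simp only [mem_closedBall, not_le] at hx
    simp [hχ x (by linarith)]
  · exact (ball_subset_closedBall.trans (closedBall_subset_closedBall (by linarith))).trans hδG
  · intro x hx
    have : χ x = 1 := χ.one_of_mem_closedBall (ball_subset_closedBall hx)
    simp [this]

variable [MeasurableSpace E] [BorelSpace E]

/-- The mean value property with respect to the kernel `K`, on all closed balls inside `G`. -/
def MeanValueOn (K : E → ℝ) (f : E → ℂ) (G : Set E) : Prop :=
  ContinuousOn f G ∧
    ∀ (y : E) (r : ℝ), 0 ≤ r → closedBall y r ⊆ G → f y = ∫ z, K z • f (y - r • z)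

theorem integrable_smul_of_hasCompactSupport {H : Type*} [NormedAddCommGroup H] [NormedSpace ℝ H]
    {K : E → ℝ} (hK : Continuous K) (hKc : HasCompactSupport K) {g : E → H} (hg : Continuous g) :
    Integrable (fun z => K z • g z) :=
  (hK.smul hg).integrable_of_hasCompactSupport hKc.smul_right

theorem hasDerivAt_integral_smul_comp {K : E → ℝ} (hK : Continuous K) (hKc : HasCompactSupport K)
    {f : E → ℂ} (hf : ContDiff ℝ 1 f) (hfc : HasCompactSupport f) {a b : E → E}
    (ha : Continuous a) (hb : Continuous b) (s₀ : ℝ) :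
    HasDerivAt (fun s : ℝ => ∫ z, K z • f (a z + s • b z))
      (∫ z, K z • fderiv ℝ f (a z + s₀ • b z) (b z)) s₀ := by
  have hfd : Continuous (fderiv ℝ f) := hf.continuous_fderiv (by simp)
  have hfcont := hf.continuous
  obtain ⟨B, hB⟩ := hfd.bounded_above_of_compact_support (hfc.fderiv ℝ)
  refine (hasDerivAt_integral_of_dominated_loc_of_deriv_le (s := univ)
    (F := fun s z => K z • f (a z + s • b z))
    (F' := fun s z => K z • fderiv ℝ f (a z + s • b z) (b z))
    (bound := fun z => ‖K z‖ * (B * ‖b z‖)) univ_mem ?_ ?_ ?_ ?_ ?_ ?_).2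
  · exact Eventually.of_forall fun s => (integrable_smul_of_hasCompactSupport hK hKc (by fun_prop)).aestronglyMeasurable
  · exact integrable_smul_of_hasCompactSupport hK hKc (by fun_prop)
  · exact (integrable_smul_of_hasCompactSupport hK hKc (by fun_prop)).aestronglyMeasurable
  · refine Eventually.of_forall fun z s _ => ?_
    rw [norm_smul]
    gcongr
    exact ContinuousLinearMap.le_of_opNorm_le _ (hB _) _
  · refine Continuous.integrable_of_hasCompactSupport (by fun_prop) ?_
    exact hKc.norm.mul_right
  · refine Eventually.of_forall fun z s _ => ?_
    have h1 : HasDerivAt (fun s : ℝ => a z + s • b z) (b z) s := by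
      simpa using ((hasDerivAt_id s).smul_const (b z)).const_add (a z)
    exact (((hf.differentiable (by simp)).differentiableAt.hasFDerivAt).comp_hasDerivAt s h1).const_smul
      (K z)

/-- Only the values of the function on the closed ball matter in the mean value integral. -/
theorem integral_kernel_congr {H : Type*} [NormedAddCommGroup H] [NormedSpace ℝ H] {K : E → ℝ}
    (hK0 : ∀ z, 1 ≤ ‖z‖ → K z = 0) {g h : E → H}
    {y : E} {r : ℝ} (hr : 0 ≤ r) (hgh : EqOn g h (closedBall y r)) :
    ∫ z, K z • g (y - r • z) = ∫ z, K z • h (y - r • z) := by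
  refine integral_congr_ae (Eventually.of_forall fun z => ?_)
  rcases le_or_gt 1 ‖z‖ with hz | hz
  · simp [hK0 z hz]
  · have : y - r • z ∈ closedBall y r := by
      simp only [mem_closedBall, dist_eq_norm, sub_sub_cancel_left, norm_neg, norm_smul,
        Real.norm_of_nonneg hr]
      nlinarith
    simp only [hgh this]

/-- Integration by parts against a function with compact support and continuous derivative. -/
theorem integral_fderiv_smul_comp_sub {ψ : E → ℝ} (hψ : ContDiff ℝ 1 ψ)
    (hψc : HasCompactSupport ψ) {g : E → ℂ} (hg : ContDiff ℝ 1 g) (y v : E) (s : ℝ) :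
    ∫ z, fderiv ℝ ψ z v • g (y + s • (-z)) =
      s • ∫ z, ψ z • fderiv ℝ g (y + s • (-z)) v := by
  have hgc := hg.continuous
  have hψcont := hψ.continuous
  have hgd : Continuous (fderiv ℝ g) := hg.continuous_fderiv (by simp)
  have hψd : Continuous (fderiv ℝ ψ) := hψ.continuous_fderiv (by simp)
  have hd : ∀ z, HasFDerivAt (fun z => g (y + s • (-z)))
      ((fderiv ℝ g (y + s • (-z))).comp (s • (-ContinuousLinearMap.id ℝ E))) z := by
    intro z
    have h1 : HasFDerivAt (fun z : E => y + s • (-z)) (s • (-ContinuousLinearMap.id ℝ E)) z :=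
      ((hasFDerivAt_id z).neg.const_smul s).const_add y
    exact ((hg.differentiable (by simp)).differentiableAt.hasFDerivAt
      (x := y + s • (-z))).comp z h1
  have hd' : ∀ z, fderiv ℝ (fun z => g (y + s • (-z))) z v =
      -(s • fderiv ℝ g (y + s • (-z)) v) := by
    intro z
    rw [(hd z).fderiv]
    simp
  have hb := integral_smul_fderiv_eq_neg_fderiv_smul_of_integrable (μ := volume) (f := ψ)
    (g := fun z => g (y + s • (-z))) (v := v) ?_ ?_ ?_
    (fun z _ => (hψ.differentiable (by simp)).differentiableAt)
    (fun z _ => (hd z).differentiableAt)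
  · rw [eq_comm, neg_eq_iff_eq_neg] at hb
    rw [hb, ← integral_neg, ← integral_smul]
    refine integral_congr_ae (Eventually.of_forall fun z => ?_)
    simp only [hd']
    rw [smul_neg, neg_neg, smul_comm]
  · exact integrable_smul_of_hasCompactSupport (by fun_prop) (hψc.fderiv_apply ℝ v) (by fun_prop)
  · simp only [hd']
    exact integrable_smul_of_hasCompactSupport hψcont hψc (by fun_prop)
  · exact integrable_smul_of_hasCompactSupport hψcont hψc (by fun_prop)

/-- Harmonic functions have the mean value property. -/
theorem meanValueOn_of_laplacian_eq_zero {K ψ : E → ℝ} (hK : Continuous K)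
    (hK0 : ∀ z, 1 ≤ ‖z‖ → K z = 0) (hψ0 : ∀ z, 1 ≤ ‖z‖ → ψ z = 0)
    (hψ : ∀ z, HasFDerivAt ψ (-(K z) • innerSL ℝ z) z) (hK1 : ∫ z, K z = 1)
    {f : E → ℂ} {G : Set E} (hG : IsOpen G) (hf : ContDiffOn ℝ 2 f G)
    (hΔ : ∀ x ∈ G, Δ f x = 0) : MeanValueOn K f G := by
  refine ⟨hf.continuousOn, fun y r hr hyr => ?_⟩
  obtain ⟨f₁, ε, hε, hf₁, hf₁c, hεG, hff₁⟩ :=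
    exists_hasCompactSupport_eqOn_ball (n := 2) hf hG hr hyr
  have hKc := hasCompactSupport_of_one_le_norm hK0
  have hψc := hasCompactSupport_of_one_le_norm hψ0
  have hψcont : Continuous ψ := continuous_iff_continuousAt.2 fun z => (hψ z).continuousAt
  have hD1 : ContDiff ℝ 1 (fderiv ℝ f₁) := hf₁.fderiv_right (by norm_num)
  have hDc : Continuous (fderiv ℝ f₁) := hD1.continuous
  have hDDc : Continuous (fderiv ℝ (fderiv ℝ f₁)) := hD1.continuous_fderiv (by simp)
  have hψd : fderiv ℝ ψ = fun z => -(K z) • innerSL ℝ z := funext fun z => (hψ z).fderiv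
  have hψ1 : ContDiff ℝ 1 ψ := by
    refine contDiff_one_iff_fderiv.2 ⟨fun z => (hψ z).differentiableAt, ?_⟩
    rw [hψd]
    fun_prop
  have hψdc : Continuous (fderiv ℝ ψ) := hψ1.continuous_fderiv (by simp)
  let e := stdOrthonormalBasis ℝ E
  have hsub : closedBall y r ⊆ ball y (r + ε) := closedBall_subset_ball (by linarith)
  have hzero : ∀ s ∈ Icc 0 r,
      ∫ z, K z • fderiv ℝ f₁ (y + s • (-z)) (-z) = 0 := by
    intro s hs
    have hparts : ∀ i, ∫ z, fderiv ℝ ψ z (e i) • fderiv ℝ f₁ (y + s • (-z)) (e i) =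
        s • ∫ z, ψ z • fderiv ℝ (fderiv ℝ f₁) (y + s • (-z)) (e i) (e i) := by
      intro i
      rw [integral_fderiv_smul_comp_sub (g := fun x => fderiv ℝ f₁ x (e i)) hψ1 hψc
        (hD1.clm_apply contDiff_const) y (e i) s]
      refine congrArg (s • ·) (integral_congr_ae (Eventually.of_forall fun z => ?_))
      simp only []
      rw [fderiv_clm_apply (hD1.differentiable (by simp)).differentiableAt
        (differentiableAt_const _)]
      simp
    have hexp : ∀ z, K z • fderiv ℝ f₁ (y + s • (-z)) (-z) =
        ∑ i, fderiv ℝ ψ z (e i) • fderiv ℝ f₁ (y + s • (-z)) (e i) := by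
      intro z
      have hz : -z = ∑ i, (-⟪z, e i⟫) • e i := by
        conv_lhs => rw [← e.sum_repr' z]
        simp [real_inner_comm]
      conv_lhs => enter [2, 2]; rw [hz]
      rw [map_sum, Finset.smul_sum]
      refine Finset.sum_congr rfl fun i _ => ?_
      rw [(hψ z).fderiv, map_smul, smul_smul]
      simp
    simp_rw [hexp]
    rw [integral_finsetSum]
    · simp_rw [hparts]
      rw [← Finset.smul_sum, ← integral_finsetSum]
      · have : ∀ z, ∑ i, ψ z • fderiv ℝ (fderiv ℝ f₁) (y + s • (-z)) (e i) (e i) = 0 := by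
          intro z
          rcases le_or_gt 1 ‖z‖ with hz | hz
          · simp [hψ0 z hz]
          · have hm : y + s • (-z) ∈ ball y (r + ε) := by
              apply hsub
              simp only [mem_closedBall, dist_eq_norm, add_sub_cancel_left, norm_neg, norm_smul,
                Real.norm_of_nonneg hs.1]
              nlinarith [hs.2, hs.1, norm_nonneg z]
            have h1 : Δ f₁ (y + s • (-z)) = 0 := by
              rw [(InnerProductSpace.laplacian_congr_nhds
                (hff₁.eventuallyEq_of_mem (isOpen_ball.mem_nhds hm))).eq_of_nhds]
              exact hΔ _ (hεG hm)
            rw [InnerProductSpace.laplacian_eq_iteratedFDeriv_orthonormalBasis f₁ e] at h1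
            simp only [iteratedFDeriv_two_apply] at h1
            rw [← Finset.smul_sum]
            simpa using Or.inr h1
        rw [integral_congr_ae (Eventually.of_forall this), integral_zero, smul_zero]
      · intro i _
        exact integrable_smul_of_hasCompactSupport hψcont hψc (by fun_prop)
    · intro i _
      exact integrable_smul_of_hasCompactSupport (by fun_prop) (hψc.fderiv_apply ℝ (e i))
        (by fun_prop)
  have hder := fun s => hasDerivAt_integral_smul_comp hK hKc (hf₁.of_le (by norm_num)) hf₁c
    (a := fun _ => y) (b := fun z => -z) continuous_const continuous_neg s
  have hconst := constant_of_has_deriv_right_zero (a := 0) (b := r)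
    (fun s _ => (hder s).continuousAt.continuousWithinAt)
    (fun s hs => by
      have := (hder s).hasDerivWithinAt (s := Ici s)
      rwa [hzero s ⟨hs.1, hs.2.le⟩] at this) r (right_mem_Icc.2 hr)
  simp only [zero_smul, sub_zero, integral_smul_const, hK1, one_smul, smul_neg,
    ← sub_eq_add_neg] at hconst
  rw [← hff₁ (hsub (mem_closedBall_self hr)), ← hconst]
  exact integral_kernel_congr hK0 hr (hff₁.mono hsub)

end MeanValue

section MeanValueProperties

variable {E : Type*} [NormedAddCommGroup E] [InnerProductSpace ℝ E] [FiniteDimensional ℝ E]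
  [MeasurableSpace E] [BorelSpace E]

theorem MeanValueOn.mono {K : E → ℝ} {f : E → ℂ} {G H : Set E} (h : MeanValueOn K f G)
    (hHG : H ⊆ G) : MeanValueOn K f H :=
  ⟨h.1.mono hHG, fun y r hr hy => h.2 y r hr (hy.trans hHG)⟩

/-- Averages of a continuous function against a smooth kernel are smooth. -/
theorem contDiff_integral_smul_sub {K : E → ℝ} (hK : ContDiff ℝ ∞ K) (hKc : HasCompactSupport K)
    {f : E → ℂ} (hf : Continuous f) {r : ℝ} (hr : 0 < r) :
    ContDiff ℝ ∞ (fun y => ∫ z, K z • f (y - r • z)) := by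
  have hKr : ContDiff ℝ ∞ (fun w : E => K (r⁻¹ • w)) := hK.comp (contDiff_const_smul _)
  have hKrc : HasCompactSupport (fun w : E => K (r⁻¹ • w)) :=
    hKc.comp_smul (inv_ne_zero hr.ne')
  let L : ℂ →L[ℝ] ℝ →L[ℝ] ℂ :=
    (ContinuousLinearMap.lsmul ℝ ℝ : ℝ →L[ℝ] ℂ →L[ℝ] ℂ).flip
  have hconv := hKrc.contDiff_convolution_right (μ := volume) (n := ⊤)
    L (hf.locallyIntegrable) hKr
  have : (fun y => ∫ z, K z • f (y - r • z)) =
      fun y => (|(r ^ Module.finrank ℝ E)⁻¹| : ℝ) •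
        (convolution f (fun w : E => K (r⁻¹ • w)) L
          volume) y := by
    funext y
    rw [convolution_eq_swap]
    rw [← Measure.integral_comp_smul (μ := volume)
      (fun t : E => L (f (y - t)) (K (r⁻¹ • t))) r]
    refine integral_congr_ae (Eventually.of_forall fun z => ?_)
    simp [L, smul_smul, inv_mul_cancel₀ hr.ne']
  rw [this]
  exact hconv.const_smul |(r ^ Module.finrank ℝ E)⁻¹|

theorem MeanValueOn.contDiffOn {K : E → ℝ} (hK : ContDiff ℝ ∞ K)
    (hK0 : ∀ z, 1 ≤ ‖z‖ → K z = 0) {f : E → ℂ} {G : Set E} (hG : IsOpen G)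
    (h : MeanValueOn K f G) : ContDiffOn ℝ ∞ f G := by
  intro y hy
  refine ContDiffAt.contDiffWithinAt ?_
  obtain ⟨r, hr, hrG⟩ := nhds_basis_closedBall.mem_iff.1 (hG.mem_nhds hy)
  obtain ⟨f₁, ε, hε, hf₁, -, hεG, hff₁⟩ :=
    exists_hasCompactSupport_eqOn_ball (n := 0) (contDiffOn_zero.2 h.1) hG hr.le hrG
  refine (contDiff_integral_smul_sub hK (hasCompactSupport_of_one_le_norm hK0)
    hf₁.continuous hr).contDiffAt.congr_of_eventuallyEq ?_
  filter_upwards [ball_mem_nhds y hε] with x hx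
  have hsub : closedBall x r ⊆ ball y (r + ε) :=
    closedBall_subset_ball' (by linarith [mem_ball.1 hx])
  rw [h.2 x r hr.le (hsub.trans hεG)]
  exact (integral_kernel_congr hK0 hr.le (hff₁.mono hsub)).symm

/-- Directional derivatives inherit the mean value property. -/
theorem MeanValueOn.fderiv_apply {K : E → ℝ} (hK : ContDiff ℝ ∞ K)
    (hK0 : ∀ z, 1 ≤ ‖z‖ → K z = 0) {f : E → ℂ} {G : Set E} (hG : IsOpen G)
    (h : MeanValueOn K f G) (v : E) : MeanValueOn K (fun x => fderiv ℝ f x v) G := by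
  have hf := h.contDiffOn hK hK0 hG
  have hKc := hasCompactSupport_of_one_le_norm hK0
  refine ⟨(hf.continuousOn_fderiv_of_isOpen hG (by simp)).clm_apply continuousOn_const,
    fun y r hr hyr => ?_⟩
  obtain ⟨f₁, ε, hε, hf₁, hf₁c, hεG, hff₁⟩ :=
    exists_hasCompactSupport_eqOn_ball (n := 1) (hf.of_le (by simp)) hG hr hyr
  have hsub : closedBall y r ⊆ ball y (r + ε) := closedBall_subset_ball (by linarith)
  have hfd : EqOn (fderiv ℝ f₁) (fderiv ℝ f) (ball y (r + ε)) := fun x hx =>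
    (hff₁.eventuallyEq_of_mem (isOpen_ball.mem_nhds hx)).fderiv_eq
  have h1 := hasDerivAt_integral_smul_comp hK.continuous hKc hf₁ hf₁c
    (a := fun z => y - r • z) (b := fun _ => v) (by fun_prop) continuous_const 0
  have hline : HasDerivAt (fun s : ℝ => y + s • v) v 0 := by
    simpa using ((hasDerivAt_id (0 : ℝ)).smul_const v).const_add y
  have h2 : HasDerivAt (fun s : ℝ => f (y + s • v)) (fderiv ℝ f y v) 0 := by
    have hd : HasFDerivAt f (fderiv ℝ f y) (y + (0 : ℝ) • v) := by
      rw [zero_smul, add_zero]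
      exact ((hf.contDiffAt (hG.mem_nhds (hyr (mem_closedBall_self hr)))).differentiableAt
        (by simp)).hasFDerivAt
    exact hd.comp_hasDerivAt _ hline
  have h3 : (fun s : ℝ => f (y + s • v)) =ᶠ[𝓝 0]
      fun s => ∫ z, K z • f₁ (y - r • z + s • v) := by
    have hc : Tendsto (fun s : ℝ => y + s • v) (𝓝 0) (𝓝 y) := by
      simpa using hline.continuousAt.tendsto
    filter_upwards [hc (ball_mem_nhds y hε)] with s hs
    have hsub' : closedBall (y + s • v) r ⊆ ball y (r + ε) :=
      closedBall_subset_ball' (by linarith [mem_ball.1 (mem_preimage.1 hs)])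
    rw [h.2 _ r hr (hsub'.trans hεG), ← integral_kernel_congr hK0 hr (hff₁.mono hsub')]
    simp only [sub_add_eq_add_sub]
  change fderiv ℝ f y v = _
  rw [h2.unique (h1.congr_of_eventuallyEq h3)]
  simp only [zero_smul, add_zero]
  exact integral_kernel_congr hK0 hr (g := fun x => fderiv ℝ f₁ x v)
    (h := fun x => fderiv ℝ f x v) fun x hx => by simp only [hfd (hsub hx)]

/-- Interior gradient estimate for functions with the mean value property. -/
theorem exists_norm_fderiv_le {K : E → ℝ} (hK : ContDiff ℝ ∞ K)
    (hK0 : ∀ z, 1 ≤ ‖z‖ → K z = 0) :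
    ∃ C : ℝ, 0 ≤ C ∧ ∀ (f : E → ℂ) (G : Set E), IsOpen G → MeanValueOn K f G →
      ∀ (y : E) (r M : ℝ), 0 < r → closedBall y r ⊆ G → (∀ x ∈ closedBall y r, ‖f x‖ ≤ M) →
        ∀ v : E, ‖v‖ = 1 → ‖fderiv ℝ f y v‖ ≤ C / r * M := by
  have hKc := hasCompactSupport_of_one_le_norm hK0
  have hKd : Continuous (fderiv ℝ K) := hK.continuous_fderiv (by simp)
  have hKi : Integrable (fun z => ‖fderiv ℝ K z‖) :=
    hKd.norm.integrable_of_hasCompactSupport (hKc.fderiv ℝ).norm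
  refine ⟨∫ z, ‖fderiv ℝ K z‖, integral_nonneg fun _ => norm_nonneg _,
    fun f G hG h y r M hr hyr hM v hv => ?_⟩
  have hf := h.contDiffOn hK hK0 hG
  obtain ⟨f₁, ε, hε, hf₁, hf₁c, hεG, hff₁⟩ :=
    exists_hasCompactSupport_eqOn_ball (n := 1) (hf.of_le (by simp)) hG hr.le hyr
  have hsub : closedBall y r ⊆ ball y (r + ε) := closedBall_subset_ball (by linarith)
  have hfd : EqOn (fderiv ℝ f₁) (fderiv ℝ f) (ball y (r + ε)) := fun x hx =>
    (hff₁.eventuallyEq_of_mem (isOpen_ball.mem_nhds hx)).fderiv_eq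
  have h1 := (h.fderiv_apply hK hK0 hG v).2 y r hr.le hyr
  have h2 : fderiv ℝ f y v = ∫ z, K z • fderiv ℝ f₁ (y + r • (-z)) v := by
    simp only [smul_neg, ← sub_eq_add_neg]
    refine h1.trans ?_
    exact integral_kernel_congr hK0 hr.le (g := fun x => fderiv ℝ f x v)
      (h := fun x => fderiv ℝ f₁ x v) fun x hx => by simp only [hfd (hsub hx)]
  have h3 := integral_fderiv_smul_comp_sub (hK.of_le (by simp)) hKc hf₁ y v r
  rw [← h2] at h3
  have h4 : fderiv ℝ f y v = r⁻¹ • ∫ z, fderiv ℝ K z v • f₁ (y + r • (-z)) := by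
    rw [h3, smul_smul, inv_mul_cancel₀ hr.ne', one_smul]
  have hK' : ∀ z, 1 < ‖z‖ → fderiv ℝ K z = 0 := by
    intro z hz
    have : K =ᶠ[𝓝 z] fun _ => 0 := by
      filter_upwards [continuous_norm.continuousAt.eventually (lt_mem_nhds hz)] with w hw
      exact hK0 w hw.le
    rw [this.fderiv_eq, fderiv_fun_const]
    rfl
  have h5 : ‖∫ z, fderiv ℝ K z v • f₁ (y + r • (-z))‖ ≤ ∫ z, ‖fderiv ℝ K z‖ * M := by
    refine norm_integral_le_of_norm_le (hKi.mul_const M) (Eventually.of_forall fun z => ?_)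
    rcases lt_or_ge 1 ‖z‖ with hz | hz
    · simp [hK' z hz]
    · have hm : y + r • (-z) ∈ closedBall y r := by
        simp only [mem_closedBall, dist_eq_norm, add_sub_cancel_left, norm_neg, norm_smul,
          Real.norm_of_nonneg hr.le]
        nlinarith
      rw [norm_smul, hff₁ (hsub hm)]
      refine mul_le_mul ?_ (hM _ hm) (norm_nonneg _) (norm_nonneg _)
      simpa [hv] using (fderiv ℝ K z).le_opNorm v
  rw [h4, norm_smul, norm_inv, Real.norm_of_nonneg hr.le]
  rw [integral_mul_const] at h5
  calc r⁻¹ * _ ≤ r⁻¹ * ((∫ z, ‖fderiv ℝ K z‖) * M) := by gcongr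
    _ = _ := by ring

end MeanValueProperties

section Taylor

/-- Taylor estimate for a chain of derivatives vanishing at `0`. -/
theorem norm_le_of_hasDerivAt_chain (n : ℕ) : ∀ (g : ℕ → ℝ → ℂ) (S B : ℝ),
    (∀ k < n, ∀ s ∈ Icc 0 S, HasDerivAt (g k) (g (k + 1) s) s) → (∀ k < n, g k 0 = 0) →
      (∀ s ∈ Icc 0 S, ‖g n s‖ ≤ B) →
        ∀ s ∈ Icc 0 S, ‖g 0 s‖ ≤ B * (s ^ n / n.factorial) := by
  induction n with
  | zero =>
    intro g S B _ _ hB s hs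
    simpa using hB s hs
  | succ n ih =>
    intro g S B hg h0 hB s hs
    have h1 := ih (fun k => g (k + 1)) S B (fun k hk => hg (k + 1) (by omega))
      (fun k hk => h0 (k + 1) (by omega)) hB
    refine image_norm_le_of_norm_deriv_right_le_deriv_boundary (a := 0) (b := S) (f' := g 1)
      (B := fun s => B * (s ^ (n + 1) / (n + 1).factorial))
      (B' := fun s => B * (s ^ n / n.factorial))
      (fun s hs => (hg 0 (by omega) s hs).continuousAt.continuousWithinAt)
      (fun s hs => (hg 0 (by omega) s ⟨hs.1, hs.2.le⟩).hasDerivWithinAt)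
      (by simp [h0 0 (by omega)]) (fun s => ?_) (fun s hs => h1 s ⟨hs.1, hs.2.le⟩) hs
    have := ((hasDerivAt_pow (n + 1) s).div_const ((n + 1).factorial : ℝ)).const_mul B
    refine this.congr_deriv ?_
    rw [Nat.factorial_succ]
    push_cast
    field_simp

end Taylor

section UniqueContinuation

variable {E : Type*} [NormedAddCommGroup E] [InnerProductSpace ℝ E]

/-- The iterated directional derivative of order `k` in the direction `v`. -/
noncomputable def iteratedDirDeriv (v : E) (k : ℕ) (f : E → ℂ) : E → ℂ :=
  (fun (g : E → ℂ) x => fderiv ℝ g x v)^[k] f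

theorem iteratedDirDeriv_succ (v : E) (k : ℕ) (f : E → ℂ) (x : E) :
    iteratedDirDeriv v (k + 1) f x = fderiv ℝ (iteratedDirDeriv v k f) x v := by
  rw [iteratedDirDeriv, Function.iterate_succ_apply']
  rfl

theorem iteratedDirDeriv_eventuallyEq_zero (v : E) (k : ℕ) {f : E → ℂ} {x : E}
    (hf : f =ᶠ[𝓝 x] 0) : iteratedDirDeriv v k f =ᶠ[𝓝 x] 0 := by
  induction k with
  | zero => exact hf
  | succ k ih =>
    filter_upwards [ih.fderiv (𝕜 := ℝ)] with y hy
    rw [iteratedDirDeriv_succ, hy]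
    simp

variable [FiniteDimensional ℝ E]

section

variable [MeasurableSpace E] [BorelSpace E]

theorem MeanValueOn.iteratedDirDeriv {K : E → ℝ} (hK : ContDiff ℝ ∞ K)
    (hK0 : ∀ z, 1 ≤ ‖z‖ → K z = 0) {f : E → ℂ} {G : Set E} (hG : IsOpen G)
    (h : MeanValueOn K f G) (v : E) (k : ℕ) : MeanValueOn K (iteratedDirDeriv v k f) G := by
  induction k with
  | zero => exact h
  | succ k ih =>
    rw [show _root_.iteratedDirDeriv v (k + 1) f =
      fun x => fderiv ℝ (_root_.iteratedDirDeriv v k f) x v from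
        funext fun x => iteratedDirDeriv_succ v k f x]
    exact ih.fderiv_apply hK hK0 hG v

/-- If a bounded function with the mean value property on a ball vanishes near the center, then it
vanishes on a concentric ball of comparable radius. -/
theorem exists_eqOn_zero_ball {K : E → ℝ} (hK : ContDiff ℝ ∞ K) (hK0 : ∀ z, 1 ≤ ‖z‖ → K z = 0) :
    ∃ ρ : ℝ, 0 < ρ ∧ ρ ≤ 1 ∧ ∀ (f : E → ℂ) (x : E) (R M : ℝ), 0 < R →
      MeanValueOn K f (ball x R) → (∀ y ∈ ball x R, ‖f y‖ ≤ M) → f =ᶠ[𝓝 x] 0 →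
        ∀ y ∈ ball x (ρ * R), f y = 0 := by
  obtain ⟨C, hC, hCf⟩ := exists_norm_fderiv_le hK hK0
  have hC1 : 0 < 8 * (C + 1) := by positivity
  refine ⟨1 / (8 * (C + 1)), by positivity, ?_, fun f x R M hR h hM hx y hy => ?_⟩
  · rw [div_le_one hC1]; linarith
  rcases eq_or_ne y x with rfl | hyx
  · exact hx.eq_of_nhds
  set s := ‖y - x‖ with hs
  have hs0 : 0 < s := norm_pos_iff.2 (sub_ne_zero.2 hyx)
  have hsR : 8 * (C + 1) * s < R := by
    rw [mem_ball, dist_eq_norm, ← hs, one_div, inv_mul_eq_div, lt_div_iff₀ hC1] at hy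
    linarith
  set v := s⁻¹ • (y - x) with hv
  have hv1 : ‖v‖ = 1 := by
    rw [hv, norm_smul, norm_inv, Real.norm_of_nonneg hs0.le, ← hs, inv_mul_cancel₀ hs0.ne']
  have hM0 : 0 ≤ M := (norm_nonneg _).trans (hM x (mem_ball_self hR))
  have hmv := h.iteratedDirDeriv hK hK0 isOpen_ball v
  have hbound : ∀ (r : ℝ), 0 < r → ∀ k : ℕ, ∀ z ∈ ball x (R - k * r),
      ‖iteratedDirDeriv v k f z‖ ≤ (C / r) ^ k * M := by
    intro r hr k
    induction k with
    | zero =>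
      intro z hz
      have := hM z (by simpa using hz)
      simpa [_root_.iteratedDirDeriv] using this
    | succ k ih =>
      intro z hz
      have hsub : closedBall z r ⊆ ball x (R - k * r) := by
        refine closedBall_subset_ball' ?_
        have := mem_ball.1 hz
        push_cast at this
        linarith
      rw [iteratedDirDeriv_succ, pow_succ', mul_assoc]
      exact hCf _ _ isOpen_ball (hmv k) z r _ hr
        (hsub.trans (ball_subset_ball (sub_le_self _ (by positivity))))
        (fun w hw => ih w (hsub hw)) v hv1
  have hmem : ∀ t ∈ Icc 0 s, x + t • v ∈ ball x (R / 2) := by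
    intro t ht
    rw [mem_ball, dist_eq_norm, add_sub_cancel_left, norm_smul, hv1, mul_one,
      Real.norm_of_nonneg ht.1]
    nlinarith [ht.2]
  have hy' : x + s • v = y := by
    rw [hv, smul_smul, mul_inv_cancel₀ hs0.ne', one_smul, add_sub_cancel]
  have key : ∀ n : ℕ, ‖f y‖ ≤ M * (3 / 4) ^ (n + 1) := by
    intro n
    set m := n + 1 with hm
    have hm0 : (0 : ℝ) < m := by rw [hm]; positivity
    have h1 := norm_le_of_hasDerivAt_chain m (fun k t => iteratedDirDeriv v k f (x + t • v)) s
      ((C / (R / (2 * m))) ^ m * M) ?_ ?_ ?_ s (right_mem_Icc.2 hs0.le)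
    · simp only [hy'] at h1
      refine h1.trans ?_
      have h2 := Real.pow_div_factorial_le_exp (m : ℝ) (Nat.cast_nonneg (α := ℝ) m) m
      have h3 : Real.exp m ≤ 3 ^ m := by
        rw [← mul_one (m : ℝ), Real.exp_nat_mul]
        gcongr
        exact Real.exp_one_lt_three.le
      calc (C / (R / (2 * m))) ^ m * M * (s ^ m / m.factorial)
          = M * (2 * C * s / R) ^ m * ((m : ℝ) ^ m / m.factorial) := by
            field_simp
            ring
        _ ≤ M * (2 * C * s / R) ^ m * 3 ^ m := by
            gcongr
            exact h2.trans h3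
        _ = M * (2 * C * s / R * 3) ^ m := by rw [mul_pow]; ring
        _ ≤ M * (3 / 4) ^ m := by
            gcongr
            rw [div_mul_eq_mul_div, div_le_iff₀ hR]
            nlinarith
    · intro k _ t ht
      have h2 : DifferentiableAt ℝ (iteratedDirDeriv v k f) (x + t • v) :=
        (((hmv k).contDiffOn hK hK0 isOpen_ball).contDiffAt (isOpen_ball.mem_nhds
          (ball_subset_ball (by linarith) (hmem t ht)))).differentiableAt (by simp)
      have h3 : HasDerivAt (fun t : ℝ => x + t • v) v t := by
        simpa using ((hasDerivAt_id t).smul_const v).const_add x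
      have h4 := h2.hasFDerivAt.comp_hasDerivAt t h3
      rw [← iteratedDirDeriv_succ] at h4
      exact h4
    · intro k _
      simpa using (iteratedDirDeriv_eventuallyEq_zero v k hx).eq_of_nhds
    · intro t ht
      refine hbound _ (by positivity) m _ ?_
      have : R - m * (R / (2 * m)) = R / 2 := by field_simp; ring
      rw [this]
      exact hmem t ht
  have hlim : Tendsto (fun n : ℕ => M * (3 / 4 : ℝ) ^ (n + 1)) atTop (𝓝 0) := by
    simpa using ((tendsto_pow_atTop_nhds_zero_of_lt_one (by norm_num : (0 : ℝ) ≤ 3 / 4)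
      (by norm_num)).comp (tendsto_add_atTop_nat 1)).const_mul M
  exact norm_le_zero_iff.1 (ge_of_tendsto' hlim key)

end

/-- **Unique continuation** for harmonic functions. -/
theorem eqOn_zero_of_laplacian_eq_zero {f : E → ℂ} {G : Set E} (hG : IsOpen G)
    (hGc : IsPreconnected G) (hf : ContDiffOn ℝ 2 f G) (hΔ : ∀ x ∈ G, Δ f x = 0) {x₀ : E}
    (hx₀ : x₀ ∈ G) (hf₀ : f =ᶠ[𝓝 x₀] 0) : EqOn f 0 G := by
  borelize E
  obtain ⟨K, ψ, hK, hK0, hψ0, hψ, hK1⟩ := exists_radial_kernel (E := E)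
  have hmv := meanValueOn_of_laplacian_eq_zero hK.continuous hK0 hψ0 hψ hK1 hG hf hΔ
  obtain ⟨ρ, hρ, hρ1, hvanish⟩ := exists_eqOn_zero_ball hK hK0
  have hsub : G ⊆ {x | f =ᶠ[𝓝 x] 0} := by
    refine hGc.subset_of_closure_inter_subset isOpen_setOfPred_eventually_nhds ⟨x₀, hx₀, hf₀⟩ ?_
    rintro x ⟨hxc, hxG⟩
    obtain ⟨R, hR, hRG⟩ := nhds_basis_closedBall.mem_iff.1 (hG.mem_nhds hxG)
    obtain ⟨M, hM⟩ := (isCompact_closedBall x R).exists_bound_of_continuousOn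
      (hf.continuousOn.mono hRG)
    obtain ⟨x', hx', hd⟩ := Metric.mem_closure_iff.1 hxc (ρ * (R / 2)) (by positivity)
    have hball : ball x' (R / 2) ⊆ closedBall x R := by
      refine ball_subset_closedBall.trans (closedBall_subset_closedBall' ?_)
      rw [dist_comm]
      nlinarith
    have hz := hvanish f x' (R / 2) M (by positivity) (hmv.mono (hball.trans hRG))
      (fun y hy => hM y (hball hy)) hx'
    filter_upwards [isOpen_ball.mem_nhds (mem_ball.2 hd)] with y hy
    exact hz y hy
  exact fun x hx => (hsub hx).eq_of_nhds

end UniqueContinuation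

section Polyharmonic

variable {E : Type*} [NormedAddCommGroup E] [InnerProductSpace ℝ E] [FiniteDimensional ℝ E]

theorem iterate_laplacian_congr_nhds {f g : E → ℂ} {x : E} (h : f =ᶠ[𝓝 x] g) (N : ℕ) :
    (fun g : E → ℂ => Δ g)^[N] f =ᶠ[𝓝 x] (fun g : E → ℂ => Δ g)^[N] g := by
  induction N generalizing f g with
  | zero => exact h
  | succ N ih => exact ih (InnerProductSpace.laplacian_congr_nhds h)

theorem laplacian_comp_add_right (f : E → ℂ) (c : E) :
    Δ (fun x => f (x + c)) = fun x => Δ f (x + c) := by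
  simp only [InnerProductSpace.laplacian_eq_iteratedFDeriv_stdOrthonormalBasis,
    iteratedFDeriv_comp_add_right]

theorem iterate_laplacian_comp_add_right (f : E → ℂ) (c : E) (N : ℕ) :
    (fun g : E → ℂ => Δ g)^[N] (fun x => f (x + c)) =
      fun x => (fun g : E → ℂ => Δ g)^[N] f (x + c) := by
  induction N generalizing f with
  | zero => rfl
  | succ N ih =>
    simp only [Function.iterate_succ_apply]
    rw [laplacian_comp_add_right]
    exact ih _

theorem ContDiffOn.laplacian {n : ℕ} {f : E → ℂ} {G : Set E} (hG : IsOpen G)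
    (hf : ContDiffOn ℝ ((n + 2 : ℕ) : WithTop ℕ∞) f G) :
    ContDiffOn ℝ (n : WithTop ℕ∞) (Δ f) G := by
  have h1 : ContDiffOn ℝ ((n + 1 : ℕ) : WithTop ℕ∞) (fderiv ℝ f) G :=
    hf.fderiv_of_isOpen hG (by norm_cast)
  have h2 : ContDiffOn ℝ (n : WithTop ℕ∞) (fderiv ℝ (fderiv ℝ f)) G :=
    h1.fderiv_of_isOpen hG (by norm_cast)
  rw [InnerProductSpace.laplacian_eq_iteratedFDeriv_stdOrthonormalBasis]
  simp only [iteratedFDeriv_two_apply]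
  exact ContDiffOn.sum fun i _ => (h2.clm_apply contDiffOn_const).clm_apply contDiffOn_const

theorem PolyharmonicOn.laplacian {N : ℕ} {f : E → ℂ} {G : Set E} (hG : IsOpen G)
    (hf : PolyharmonicOn (N + 1) f G) : PolyharmonicOn N (Δ f) G :=
  ⟨ContDiffOn.laplacian hG hf.1, hf.2⟩

theorem PolyharmonicOn.mono {N : ℕ} {f : E → ℂ} {G H : Set E} (hf : PolyharmonicOn N f G)
    (h : H ⊆ G) : PolyharmonicOn N f H :=
  ⟨hf.1.mono h, fun x hx => hf.2 x (h hx)⟩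

theorem iterate_laplacian_sub {N : ℕ} {f g : E → ℂ} {G : Set E} (hG : IsOpen G)
    (hf : ContDiffOn ℝ ((2 * N : ℕ) : WithTop ℕ∞) f G)
    (hg : ContDiffOn ℝ ((2 * N : ℕ) : WithTop ℕ∞) g G) {x : E} (hx : x ∈ G) :
    (fun g : E → ℂ => Δ g)^[N] (f - g) x =
      (fun g : E → ℂ => Δ g)^[N] f x - (fun g : E → ℂ => Δ g)^[N] g x := by
  induction N generalizing f g with
  | zero => rfl
  | succ N ih =>
    simp only [Function.iterate_succ_apply]
    rw [← ih (ContDiffOn.laplacian hG hf) (ContDiffOn.laplacian hG hg)]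
    refine (iterate_laplacian_congr_nhds ?_ N).eq_of_nhds
    have h2 : (2 : WithTop ℕ∞) ≤ ((2 * (N + 1) : ℕ) : WithTop ℕ∞) := by
      norm_cast
      omega
    exact ((hf.contDiffAt (hG.mem_nhds hx)).of_le h2).laplacian_sub_nhds
      ((hg.contDiffAt (hG.mem_nhds hx)).of_le h2)

theorem PolyharmonicOn.sub {N : ℕ} {f g : E → ℂ} {G : Set E} (hG : IsOpen G)
    (hf : PolyharmonicOn N f G) (hg : PolyharmonicOn N g G) : PolyharmonicOn N (f - g) G :=
  ⟨hf.1.sub hg.1, fun x hx => by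
    rw [iterate_laplacian_sub hG hf.1 hg.1 hx, hf.2 x hx, hg.2 x hx, sub_zero]⟩

theorem PolyharmonicOn.comp_add_right {N : ℕ} {f : E → ℂ} {G : Set E}
    (hf : PolyharmonicOn N f G) (c : E) :
    PolyharmonicOn N (fun x => f (x + c)) ((· + c) ⁻¹' G) := by
  refine ⟨hf.1.comp (contDiff_id.add contDiff_const).contDiffOn fun x hx => hx, fun x hx => ?_⟩
  rw [iterate_laplacian_comp_add_right]
  exact hf.2 _ hx

/-- A function that is locally polyharmonic is polyharmonic. -/
theorem polyharmonicOn_univ_of_locally {N : ℕ} {v : E → ℂ}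
    (h : ∀ x, ∃ (f : E → ℂ) (G : Set E), IsOpen G ∧ x ∈ G ∧ PolyharmonicOn N f G ∧ v =ᶠ[𝓝 x] f) :
    PolyharmonicOn N v univ := by
  refine ⟨contDiffOn_univ.2 (contDiff_iff_contDiffAt.2 fun x => ?_), fun x _ => ?_⟩
  · obtain ⟨f, G, hG, hx, hf, hv⟩ := h x
    exact (hf.1.contDiffAt (hG.mem_nhds hx)).congr_of_eventuallyEq hv
  · obtain ⟨f, G, hG, hx, hf, hv⟩ := h x
    rw [(iterate_laplacian_congr_nhds hv N).eq_of_nhds]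
    exact hf.2 x hx

/-- **Unique continuation** for polyharmonic functions. -/
theorem PolyharmonicOn.eqOn_zero {N : ℕ} {f : E → ℂ} {G : Set E} (hG : IsOpen G)
    (hGc : IsPreconnected G) (hf : PolyharmonicOn N f G) {x₀ : E} (hx₀ : x₀ ∈ G)
    (hf₀ : f =ᶠ[𝓝 x₀] 0) : EqOn f 0 G := by
  induction N generalizing f with
  | zero => exact fun x hx => hf.2 x hx
  | succ N ih =>
    have h0 : Δ f =ᶠ[𝓝 x₀] 0 := by
      have h1 := InnerProductSpace.laplacian_congr_nhds hf₀
      have h2 : Δ (0 : E → ℂ) = 0 := InnerProductSpace.laplacian_const (c := (0 : ℂ))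
      rwa [h2] at h1
    refine eqOn_zero_of_laplacian_eq_zero hG hGc (hf.1.of_le ?_) (ih (hf.laplacian hG) h0) hx₀ hf₀
    norm_cast
    omega

end Polyharmonic

section Strip

variable {d : ℕ}

/-- The point `(s, 0)` of `ℝ × ℝ^d`. -/
noncomputable def timeShift (d : ℕ) (s : ℝ) : TimeSpace d := WithLp.toLp 2 (s, 0)

theorem continuous_timeSpace_fst : Continuous fun p : TimeSpace d => p.fst :=
  continuous_fst.comp (WithLp.prod_continuous_ofLp 2 ℝ (EuclideanSpace ℝ (Fin d)))

theorem add_timeShift_fst (p : TimeSpace d) (s : ℝ) : (p + timeShift d s).fst = p.fst + s := rfl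

theorem toLp_add_timeShift (t s : ℝ) (y : EuclideanSpace ℝ (Fin d)) :
    (WithLp.toLp 2 (t, y) : TimeSpace d) + timeShift d s = WithLp.toLp 2 (t + s, y) := by
  rw [timeShift, ← WithLp.toLp_add, Prod.mk_add_mk, add_zero]

theorem isOpen_strip (a b : ℝ) : IsOpen (strip d a b) :=
  (isOpen_lt continuous_const continuous_timeSpace_fst).inter
    (isOpen_lt continuous_timeSpace_fst continuous_const)

theorem convex_strip (a b : ℝ) : Convex ℝ (strip d a b) := by
  have : IsLinearMap ℝ fun p : TimeSpace d => p.fst := ⟨fun _ _ => rfl, fun _ _ => rfl⟩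
  exact (convex_halfSpace_gt this a).inter (convex_halfSpace_lt this b)

theorem preimage_add_timeShift_strip (a b s : ℝ) :
    (· + timeShift d s) ⁻¹' strip d a b = strip d (a - s) (b - s) := by
  ext p
  simp only [strip, mem_preimage, mem_ofPred_eq, add_timeShift_fst]
  constructor <;> rintro ⟨h1, h2⟩ <;> constructor <;> linarith

/-- A polyharmonic function on a strip that is odd at `t₁ < t₂` is periodic with period
`2 (t₂ - t₁)` wherever both sides are defined. -/
theorem PolyharmonicOn.eq_add_timeShift {N : ℕ} {a b t₁ t₂ : ℝ} {u : TimeSpace d → ℂ}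
    (hu : PolyharmonicOn N u (strip d a b)) (ht : t₁ < t₂)
    (hodd₁ : OddAt a b u t₁) (hodd₂ : OddAt a b u t₂)
    (ha : a < t₁ - (t₂ - t₁)) (hb : t₂ + (t₂ - t₁) < b) {p : TimeSpace d}
    (hp : p ∈ strip d a (b - 2 * (t₂ - t₁))) :
    u (p + timeShift d (2 * (t₂ - t₁))) = u p := by
  set T := 2 * (t₂ - t₁) with hT
  have h1 : PolyharmonicOn N (fun x => u (x + timeShift d T)) (strip d a (b - T)) := by
    have h := hu.comp_add_right (timeShift d T)
    rw [preimage_add_timeShift_strip] at h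
    refine h.mono fun x hx => ⟨?_, hx.2⟩
    linarith [hx.1]
  have h2 : PolyharmonicOn N u (strip d a (b - T)) :=
    hu.mono fun x hx => ⟨hx.1, by linarith [hx.2]⟩
  have hx₀ : timeShift d (t₁ - (t₂ - t₁)) ∈ strip d a (b - T) := ⟨ha, by
    change t₁ - (t₂ - t₁) < b - T
    linarith⟩
  refine sub_eq_zero.1 ((h1.sub (isOpen_strip _ _) h2).eqOn_zero (isOpen_strip _ _)
    (convex_strip _ _).isPreconnected hx₀ ?_ hp)
  set ε := min (t₁ - (t₂ - t₁) - a) (b - (t₂ + (t₂ - t₁))) with hε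
  have hε1 : ε ≤ t₁ - (t₂ - t₁) - a := min_le_left _ _
  have hε2 : ε ≤ b - (t₂ + (t₂ - t₁)) := min_le_right _ _
  have hε0 : 0 < ε := lt_min (by linarith) (by linarith)
  have hnear : timeShift d (t₁ - (t₂ - t₁)) ∈
      strip d (t₁ - (t₂ - t₁) - ε) (t₁ - (t₂ - t₁) + ε) := by
    constructor
    · change t₁ - (t₂ - t₁) - ε < t₁ - (t₂ - t₁)
      linarith
    · change t₁ - (t₂ - t₁) < t₁ - (t₂ - t₁) + ε
      linarith
  filter_upwards [(isOpen_strip _ _).mem_nhds hnear] with x hx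
  obtain ⟨hxl, hxr⟩ := hx
  have hxp : x = WithLp.toLp 2 (x.fst, x.snd) := rfl
  have e1 := hodd₁ (x.fst - t₁) ?_ x.snd
  have e2 := hodd₂ (x.fst + t₂ - 2 * t₁) ?_ x.snd
  · rw [show t₁ + (x.fst - t₁) = x.fst by ring] at e1
    rw [show t₂ + (x.fst + t₂ - 2 * t₁) = x.fst + T by rw [hT]; ring,
      show t₂ - (x.fst + t₂ - 2 * t₁) = t₁ - (x.fst - t₁) by ring, ← e1,
      ← toLp_add_timeShift, ← hxp] at e2
    simp [e2]
  · rw [mem_Ioo, neg_lt, lt_min_iff, lt_min_iff]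
    refine ⟨⟨?_, ?_⟩, ?_, ?_⟩ <;> linarith
  · rw [mem_Ioo, neg_lt, lt_min_iff, lt_min_iff]
    refine ⟨⟨?_, ?_⟩, ?_, ?_⟩ <;> linarith

/-- A function on a strip that agrees with its translate by `T` wherever both are defined agrees
with all its translates by integer multiples of `T`. -/
theorem eq_add_timeShift_nsmul {a b T : ℝ} (hT : 0 ≤ T) {u : TimeSpace d → ℂ}
    (hper : ∀ p ∈ strip d a (b - T), u (p + timeShift d T) = u p) (n : ℕ) {p : TimeSpace d}
    (hp : p ∈ strip d a (b - n * T)) : u (p + timeShift d (n * T)) = u p := by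
  have hadd : ∀ s t : ℝ, timeShift d s + timeShift d t = timeShift d (s + t) := fun s t =>
    toLp_add_timeShift s t 0
  induction n with
  | zero =>
    have := hadd 0 0
    simp only [add_zero, add_eq_left] at this
    simp [this]
  | succ n ih =>
    obtain ⟨h1, h2⟩ := hp
    push_cast at h2
    have hnT : 0 ≤ n * T := by positivity
    rw [← ih ⟨h1, by linarith⟩, ← hper (p + timeShift d (n * T)) ?_, add_assoc, hadd]
    · congr 3
      push_cast
      ring
    · refine ⟨?_, ?_⟩ <;> rw [add_timeShift_fst] <;> linarith

theorem eq_of_fst_sub_eq_zsmul {a b T : ℝ} (hT : 0 ≤ T) {u : TimeSpace d → ℂ}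
    (hper : ∀ p ∈ strip d a (b - T), u (p + timeShift d T) = u p) {p : TimeSpace d} {k l : ℤ}
    (hk : p + timeShift d (-(k * T)) ∈ strip d a b)
    (hl : p + timeShift d (-(l * T)) ∈ strip d a b) :
    u (p + timeShift d (-(k * T))) = u (p + timeShift d (-(l * T))) := by
  wlog h : k ≤ l generalizing k l
  · exact (this hl hk (le_of_not_ge h)).symm
  obtain ⟨n, rfl⟩ := Int.le.dest h
  have hadd : ∀ s t : ℝ, timeShift d s + timeShift d t = timeShift d (s + t) := fun s t =>
    toLp_add_timeShift s t 0
  have he : p + timeShift d (-(k * T)) =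
      p + timeShift d (-(((k + n : ℤ) : ℝ) * T)) + timeShift d (n * T) := by
    rw [add_assoc, hadd]
    congr 2
    push_cast
    ring
  rw [he] at hk ⊢
  refine eq_add_timeShift_nsmul hT hper n ⟨hl.1, ?_⟩
  have := hk.2
  rw [add_timeShift_fst] at this
  linarith

end Strip

theorem mainTheorem9 (d N : ℕ) (a b t₁ t₂ : ℝ) (u : TimeSpace d → ℂ)
    (hu : PolyharmonicOn N u (strip d a b))
    (ht₁ : t₁ ∈ Set.Ioo a b) (ht₂ : t₂ ∈ Set.Ioo a b) (ht : t₁ < t₂)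
    (hodd₁ : OddAt a b u t₁) (hodd₂ : OddAt a b u t₂)
    (ha : a < t₁ - (t₂ - t₁)) (hb : t₂ + (t₂ - t₁) < b) :
    ∃ v : TimeSpace d → ℂ,
      PolyharmonicOn N v Set.univ ∧
      Set.EqOn v u (strip d a b) ∧
      ∀ (t : ℝ) (y : EuclideanSpace ℝ (Fin d)),
        v (WithLp.toLp 2 (t + 2 * (t₂ - t₁), y)) = v (WithLp.toLp 2 (t, y)) := by
  have hper := fun p hp => hu.eq_add_timeShift (p := p) ht hodd₁ hodd₂ ha hb hp
  set T := 2 * (t₂ - t₁) with hTdef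
  have hT : 0 < T := by linarith
  set v : TimeSpace d → ℂ := fun p =>
    u (p + timeShift d (-((toIcoDiv hT (t₁ - (t₂ - t₁)) p.fst : ℤ) * T))) with hv
  have hmem : ∀ p : TimeSpace d,
      p + timeShift d (-((toIcoDiv hT (t₁ - (t₂ - t₁)) p.fst : ℤ) * T)) ∈ strip d a b := by
    intro p
    have h := sub_toIcoDiv_zsmul_mem_Ico hT (t₁ - (t₂ - t₁)) p.fst
    rw [zsmul_eq_mul] at h
    refine ⟨?_, ?_⟩ <;> rw [add_timeShift_fst] <;> linarith [h.1, h.2]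
  have hvk : ∀ (p : TimeSpace d) (k : ℤ), p + timeShift d (-(k * T)) ∈ strip d a b →
      v p = u (p + timeShift d (-(k * T))) := fun p k hk =>
    eq_of_fst_sub_eq_zsmul hT.le hper (hmem p) hk
  refine ⟨v, polyharmonicOn_univ_of_locally fun x => ?_, fun p hp => ?_, fun t y => ?_⟩
  · set c := timeShift d (-((toIcoDiv hT (t₁ - (t₂ - t₁)) x.fst : ℤ) * T)) with hc
    have hopen : IsOpen ((· + c) ⁻¹' strip d a b) :=
      (isOpen_strip a b).preimage (continuous_id.add continuous_const)
    refine ⟨fun p => u (p + c), _, hopen, hmem x, hu.comp_add_right c, ?_⟩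
    filter_upwards [hopen.mem_nhds (hmem x)] with p hp
    exact hvk p _ hp
  · have h0 : p + timeShift d (-(((0 : ℤ) : ℝ) * T)) = p := by
      have : timeShift d 0 = 0 := rfl
      simp [this]
    rw [hvk p 0 (by rwa [h0]), h0]
  · have h1 : (WithLp.toLp 2 (t + T, y) : TimeSpace d).fst = t + T := rfl
    have h2 : (WithLp.toLp 2 (t, y) : TimeSpace d).fst = t := rfl
    simp only [hv, h1, h2, toIcoDiv_add_right, toLp_add_timeShift]
    congr 3
    push_cast
    ring
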